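/- Transformations and partial transformations act on the right, so in a product $\alpha\beta$ the factor $\alpha$ is applied first. For a positive integer $k$ let $\underline{k}=\{1,\dots,k\}$, let $\mathcal{PT}_k$ be the monoid of all partial transformations of $\underline{k}$ (maps $\Gamma\to\underline{k}$ with $\Gamma\subseteq\underline{k}$, including the empty map $\varnothing$) under composition, and let $\mathcal{T}_k$ be the monoid of all maps $\underline{k}\to\underline{k}$. The wreath product $\mathcal{PT}_n\wr\mathcal{T}_m$ is the set $(\mathcal{PT}_n)^m\times\mathcal{T}_m$ with the multiplication $$(s_1,\dots,s_m;\sigma)(t_1,\dots,t_m;\tau)=(s_1t_{1\sigma},\dots,s_mt_{m\sigma};\sigma\tau).$$ A partial transformation $\alpha$ of a set $\Omega$ preserves an equivalence relation $E$ on $\Omega$ if $(x\alpha,y\alpha)\in E$ for all $x,y$ in the domain of $\alpha$ with $(x,y)\in E$. The rank of a monoid is the least cardinality of a generating set of it (as a monoid). **Theorem 1.1.** Let $m,n\ge 2$, let $\Omega$ be a finite set, let $E$ be an equivalence relation on $\Omega$ with exactly $m$ classes, each of size $n$, and let $\mathcal{PT}_E$ be the monoid of all partial transformations of $\Omega$ that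 preserve $E$. Then (i) $|\mathcal{PT}_E|=\bigl(m(n+1)^n-m+1\bigr)^m$; (ii) $\operatorname{rank}\mathcal{PT}_E=5$; (iii) $\mathcal{PT}_E\cong(\mathcal{PT}_n\wr\mathcal{T}_m)/R$, where $R$ is a congruence generated by a single pair of elements; namely, one can take for $R$ the congruence generated by the pair $(e,\,e\,\overline{\tau})$, where $e=(\varnothing,1,\dots,1;1)$, $\overline{\tau}=(1,\dots,1;\tau)$, and $\tau\in\mathcal{T}_m$ maps $1$ to $2$ and fixes $2,\dots,m$. -/

import Mathlib

/-! Transformations act on the right: in a product `α * β` the factor `α` is applied first. -/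

/-- Partial transformations of `Ω`: `α x = none` means that `x` is not in the domain of `α`,
and `α x = some y` means that `x` is in the domain and is mapped to `y`. -/
def PartialTransf (Ω : Type*) : Type _ := Ω → Option Ω

namespace PartialTransf

/-- The monoid of all partial transformations of `Ω`: the identity map, and composition from
left to right (`x (α β) = (x α) β`, defined exactly where both steps are defined). -/
instance (Ω : Type*) : Monoid (PartialTransf Ω) where
  one := fun x => some x
  mul α β := fun x => (α x).bind β
  mul_assoc α β γ := funext fun x => Option.bind_assoc (α x) β γ
  one_mul _ := rfl
  mul_one α := funext fun x => Option.bind_fun_some (α x)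

/-- The partial transformation with empty domain. -/
def empty (Ω : Type*) : PartialTransf Ω := fun _ => none

/-- `α` preserves `E`: any two `E`-related points of the domain have `E`-related images. -/
def Preserves {Ω : Type*} (E : Setoid Ω) (α : PartialTransf Ω) : Prop :=
  ∀ x y x' y' : Ω, α x = some x' → α y = some y' → E x y → E x' y'

end PartialTransf

/-- The monoid of all partial transformations that preserve the equivalence relation `E`. -/
def PTE {Ω : Type*} (E : Setoid Ω) : Submonoid (PartialTransf Ω) where
  carrier := {α | α.Preserves E}
  one_mem' := by
    intro x y x' y' hx hy h
    obtain rfl : x = x' := Option.some.inj hx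
    obtain rfl : y = y' := Option.some.inj hy
    exact h
  mul_mem' := by
    intro α β hα hβ x y x' y' hx hy h
    obtain ⟨u, hu, hu'⟩ := Option.bind_eq_some_iff.mp hx
    obtain ⟨v, hv, hv'⟩ := Option.bind_eq_some_iff.mp hy
    exact hβ u v x' y' hu' hv' (hα x y u v hu hv h)

/-- `E` is uniform with exactly `m` equivalence classes, each of which has exactly `n` elements
(meant for finite `Ω`). -/
structure IsUniformEquiv {Ω : Type*} (E : Setoid Ω) (m n : ℕ) : Prop where
  ncard_classes : E.classes.ncard = m
  ncard_class : ∀ c ∈ E.classes, c.ncard = n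

/-- (Full) transformations of `X`. -/
def FullTransf (X : Type*) : Type _ := X → X

/-- The monoid of all transformations of `X`, composed from left to right. -/
instance (X : Type*) : Monoid (FullTransf X) where
  one := fun x => x
  mul σ τ := fun x => τ (σ x)
  mul_assoc _ _ _ := rfl
  one_mul _ := rfl
  mul_one _ := rfl

/-- The underlying set `S^X × T(X)` of the wreath product of a monoid `S` by the monoid `T(X)`
of all transformations of `X`. -/
@[ext]
structure Wreath (S X : Type*) where
  comp : X → S
  bar : FullTransf X

namespace Wreath

/-- `(s; σ) (t; τ) = (j ↦ s_j t_{jσ}; σ τ)`. -/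
instance (S X : Type*) [Monoid S] : Monoid (Wreath S X) where
  one := ⟨fun _ => 1, 1⟩
  mul a b := ⟨fun j => a.comp j * b.comp (a.bar j), a.bar * b.bar⟩
  mul_assoc _ _ _ := Wreath.ext (funext fun _ => mul_assoc _ _ _) rfl
  one_mul _ := Wreath.ext (funext fun _ => one_mul _) rfl
  mul_one _ := Wreath.ext (funext fun _ => mul_one _) rfl

/-- `s ↦ (1, …, 1, s, 1, …, 1; 1)` with `s` in position `j`. -/
def coordEmb {S X : Type*} [Monoid S] [DecidableEq X] (j : X) (s : S) : Wreath S X :=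
  ⟨Function.update (fun _ => 1) j s, 1⟩

/-- `τ ↦ (1, …, 1; τ)`. -/
def barEmb {S X : Type*} [Monoid S] (τ : FullTransf X) : Wreath S X :=
  ⟨fun _ => 1, τ⟩

end Wreath

/-- The transformation that maps `j` to `k` and fixes every other point. -/
def moveTo {X : Type*} [DecidableEq X] (j k : X) : FullTransf X :=
  Function.update (fun x => x) j k

/-- The congruence generated by the single pair `(a, b)`. -/
def pairCon {M : Type*} [Monoid M] (a b : M) : Con M :=
  conGen fun x y => x = a ∧ y = b

/-- The rank of a monoid: the least size of a generating set (`⊤` if there is no finite one). -/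
noncomputable def monoidRank (M : Type*) [Monoid M] : ℕ∞ :=
  ⨅ (X : Set M) (_ : Submonoid.closure X = ⊤), X.encard

/-! Label the points of `Ω` by pairs (class, place in the class). The wreath product then acts on
`Ω`: the bar says where each class goes, the components say how. Every `E`-preserving partial map
arises (`toPTE_surjective`), and the action forgets only the target of a class whose component is
empty (`toPTE_eq_iff`). Redirecting one empty class is a two-sided translate of the given pair, and
finitely many redirections join any two elements with the same action (`ker_toPTE`). For the
cardinality, each class is independently either empty or has one of m targets and one of (n+1)^n - 1
nonempty maps (`card_PTE`).

For the lower bound on the rank, the total maps injective on classes and the total maps separating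
classes are two submonoids closed under left factors, and they meet in the units. A generating set
therefore needs a non-unit from each, a non-total map, and two units because the units do not
commute (`five_le_encard`). For the upper bound, the group Sym(n) ≀ Sym(m) is generated by two
elements (`exists_closure_pair_eq_top`), and together with three idempotents, merging two classes,
merging two points of a class and deleting a point, it generates everything
(`Wreath.eq_top_of_mem`). -/

open Equiv

/-! ### Wreath products of groups, and criteria for a subgroup to be everything -/

/-- The permutational wreath product `H ≀ Sym(X)`, with permutations of `X` acting on the right:
`(f; σ) (g; τ)` is `(j ↦ f_j g_{jσ}; στ)`. -/
@[ext]
structure PermWreath (H X : Type*) where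
  comp : X → H
  bar : Perm X

namespace PermWreath

variable {H X : Type*} [Group H]

/-- Products in `Perm X` apply the right factor first, so right actions force the reversed order
`b.bar * a.bar`. -/
instance : Mul (PermWreath H X) :=
  ⟨fun a b => ⟨fun j => a.comp j * b.comp (a.bar j), b.bar * a.bar⟩⟩

instance : One (PermWreath H X) := ⟨⟨fun _ => 1, 1⟩⟩

instance : Inv (PermWreath H X) := ⟨fun a => ⟨fun j => (a.comp (a.bar⁻¹ j))⁻¹, a.bar⁻¹⟩⟩

@[simp] theorem mul_comp (a b : PermWreath H X) (j : X) :
    (a * b).comp j = a.comp j * b.comp (a.bar j) := rfl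

@[simp] theorem mul_bar (a b : PermWreath H X) : (a * b).bar = b.bar * a.bar := rfl

@[simp] theorem one_comp (j : X) : (1 : PermWreath H X).comp j = 1 := rfl

@[simp] theorem one_bar : (1 : PermWreath H X).bar = 1 := rfl

@[simp] theorem inv_comp (a : PermWreath H X) (j : X) :
    (a⁻¹).comp j = (a.comp (a.bar⁻¹ j))⁻¹ := rfl

@[simp] theorem inv_bar (a : PermWreath H X) : (a⁻¹).bar = a.bar⁻¹ := rfl

instance : Group (PermWreath H X) :=
  Group.ofLeftAxioms
    (fun a b c => PermWreath.ext (funext fun j => by simp [mul_assoc]) (by simp [mul_assoc]))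
    (fun a => PermWreath.ext (funext fun j => by simp) (by simp))
    (fun a => PermWreath.ext (funext fun j => by simp) (by simp))

theorem pow_bar (a : PermWreath H X) (k : ℕ) : (a ^ k).bar = a.bar ^ k := by
  induction k with
  | zero => rfl
  | succ k ih => rw [pow_succ, mul_bar, ih, pow_succ']

/-- The inclusion of the base group. -/
def base : (X → H) →* PermWreath H X where
  toFun f := ⟨f, 1⟩
  map_one' := rfl
  map_mul' _ _ := PermWreath.ext rfl rfl

@[simp] theorem base_comp (f : X → H) : (base f).comp = f := rfl

@[simp] theorem base_bar (f : X → H) : (base f).bar = 1 := rfl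

theorem base_comp_eq {a : PermWreath H X} (h : a.bar = 1) : base a.comp = a :=
  PermWreath.ext rfl h.symm

theorem conj_base (a : PermWreath H X) (f : X → H) :
    a⁻¹ * base f * a = base fun k =>
      (a.comp (a.bar⁻¹ k))⁻¹ * f (a.bar⁻¹ k) * a.comp (a.bar⁻¹ k) :=
  PermWreath.ext (funext fun k => by simp) (by simp)

theorem conj_base_mulSingle [DecidableEq X] (a : PermWreath H X) (j : X) (h : H) :
    a⁻¹ * base (Pi.mulSingle j h) * a =
      base (Pi.mulSingle (a.bar j) ((a.comp j)⁻¹ * h * a.comp j)) := by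
  rw [conj_base]
  congr 1
  funext k
  by_cases hk : k = a.bar j
  · subst hk
    simp
  · have : a.bar⁻¹ k ≠ j := fun h' => hk (by rw [← h']; simp)
    rw [Pi.mulSingle_eq_of_ne this, Pi.mulSingle_eq_of_ne hk]
    simp

/-- The permutations induced on `X` by a subgroup. -/
def bars (G : Subgroup (PermWreath H X)) : Subgroup (Perm X) where
  carrier := {σ | ∃ g ∈ G, g.bar = σ}
  one_mem' := ⟨1, G.one_mem, rfl⟩
  mul_mem' := by
    rintro _ _ ⟨g, hg, rfl⟩ ⟨h, hh, rfl⟩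
    exact ⟨h * g, G.mul_mem hh hg, rfl⟩
  inv_mem' := by
    rintro _ ⟨g, hg, rfl⟩
    exact ⟨g⁻¹, G.inv_mem hg, rfl⟩

/-- The projection to the coordinate `j` of the stabilizer of `j` in a subgroup. -/
def stabProj (G : Subgroup (PermWreath H X)) (j : X) : Subgroup H where
  carrier := {h | ∃ g ∈ G, g.bar j = j ∧ g.comp j = h}
  one_mem' := ⟨1, G.one_mem, rfl, rfl⟩
  mul_mem' := by
    rintro _ _ ⟨g, hg, hgj, rfl⟩ ⟨h, hh, hhj, rfl⟩
    exact ⟨g * h, G.mul_mem hg hh, by simp [hgj, hhj], by simp [hgj]⟩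
  inv_mem' := by
    rintro _ ⟨g, hg, hgj, rfl⟩
    have : g.bar⁻¹ j = j := by rw [Perm.inv_eq_iff_eq, hgj]
    exact ⟨g⁻¹, G.inv_mem hg, this, by rw [inv_comp, this]⟩

theorem bars_eq_top {G : Subgroup (PermWreath H X)} {σ τ : Perm X}
    (h : Subgroup.closure {σ, τ} = ⊤) (hσ : σ ∈ bars G) (hτ : τ ∈ bars G) : bars G = ⊤ := by
  rw [eq_top_iff, ← h, Subgroup.closure_le]
  rintro _ (rfl | rfl)
  exacts [hσ, hτ]

theorem stabProj_eq_top {G : Subgroup (PermWreath H X)} {j : X} {s t : H}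
    (h : Subgroup.closure {s, t} = ⊤) (hs : s ∈ stabProj G j) (ht : t ∈ stabProj G j) :
    stabProj G j = ⊤ := by
  rw [eq_top_iff, ← h, Subgroup.closure_le]
  rintro _ (rfl | rfl)
  exacts [hs, ht]

variable [DecidableEq X]

/-- The elements of `H` that lie in a subgroup when placed in coordinate `j`. -/
def coordSubgroup (G : Subgroup (PermWreath H X)) (j : X) : Subgroup H :=
  G.comap (base.comp (MonoidHom.mulSingle (fun _ => H) j))

theorem mem_coordSubgroup {G : Subgroup (PermWreath H X)} {j : X} {h : H} :
    h ∈ coordSubgroup G j ↔ base (Pi.mulSingle j h) ∈ G := Iff.rfl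

theorem coordSubgroup_conj {G : Subgroup (PermWreath H X)} {a : PermWreath H X} (ha : a ∈ G)
    {j : X} {h : H} (hh : h ∈ coordSubgroup G j) :
    (a.comp j)⁻¹ * h * a.comp j ∈ coordSubgroup G (a.bar j) := by
  rw [mem_coordSubgroup, ← conj_base_mulSingle]
  exact G.mul_mem (G.mul_mem (G.inv_mem ha) hh) ha

/-- Elements of `G` fixing `j` realise every conjugation of coordinate `j`, because their components
at `j` exhaust `H`. -/
theorem coordSubgroup_normal {G : Subgroup (PermWreath H X)} {j : X} (h : stabProj G j = ⊤) :
    (coordSubgroup G j).Normal := by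
  refine ⟨fun k hk g => ?_⟩
  obtain ⟨a, ha, haj, hag⟩ : g⁻¹ ∈ stabProj G j := h ▸ Subgroup.mem_top _
  have := coordSubgroup_conj ha hk
  rwa [haj, hag, inv_inv] at this

theorem exists_bar_apply_eq {G : Subgroup (PermWreath H X)} (h : bars G = ⊤) (j k : X) :
    ∃ a ∈ G, a.bar j = k := by
  obtain ⟨a, ha, hab⟩ : swap j k ∈ bars G := h ▸ Subgroup.mem_top _
  exact ⟨a, ha, by rw [hab, swap_apply_left]⟩

/-- A normal subgroup of `H` contained in one coordinate subgroup is contained in all. -/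
theorem le_coordSubgroup {G : Subgroup (PermWreath H X)} (h : bars G = ⊤) {N : Subgroup H}
    [hN : N.Normal] {j : X} (hj : N ≤ coordSubgroup G j) (k : X) : N ≤ coordSubgroup G k := by
  obtain ⟨a, ha, rfl⟩ := exists_bar_apply_eq h j k
  intro g hg
  have := coordSubgroup_conj ha (hj (hN.conj_mem g hg (a.comp j)))
  simpa [mul_assoc] using this

variable [Finite X]

theorem base_mem_of_forall_mem {G : Subgroup (PermWreath H X)} {f : X → H}
    (h : ∀ j, f j ∈ coordSubgroup G j) : base f ∈ G :=
  Subgroup.pi_mem_of_mulSingle_mem (H := G.comap base) f h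

/-- Dividing by an element of `G` with the same bar leaves a base element, and transitivity on `X`
spreads `H` from `j` to all coordinates. -/
theorem eq_top_of_coordSubgroup {G : Subgroup (PermWreath H X)} (h : bars G = ⊤) {j : X}
    (hj : coordSubgroup G j = ⊤) : G = ⊤ := by
  rw [Subgroup.eq_top_iff']
  intro a
  obtain ⟨b, hb, hba⟩ : a.bar ∈ bars G := h ▸ Subgroup.mem_top _
  have h1 : (a * b⁻¹).bar = 1 := by simp [hba]
  have h2 : a * b⁻¹ ∈ G := by
    rw [← base_comp_eq h1]
    exact base_mem_of_forall_mem fun k =>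
      le_coordSubgroup h (N := ⊤) hj.ge k (Subgroup.mem_top _)
  simpa using G.mul_mem h2 hb

theorem eq_top_of_isSwap {Y : Type*} [Finite Y] [DecidableEq Y]
    {G : Subgroup (PermWreath (Perm Y) X)} (h : bars G = ⊤) {j : X} (hs : stabProj G j = ⊤)
    {t : Perm Y} (ht : t.IsSwap) (htG : t ∈ coordSubgroup G j) : G = ⊤ := by
  refine eq_top_of_coordSubgroup h (j := j) ?_
  have hN := coordSubgroup_normal hs
  rw [eq_top_iff, ← Perm.closure_isSwap, Subgroup.closure_le]
  rintro s ⟨c, d, hcd, rfl⟩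
  obtain ⟨a, b, hab, rfl⟩ := ht
  obtain ⟨g, hg⟩ := isConj_iff.mp (Perm.isConj_swap hab hcd)
  rw [← hg]
  exact hN.conj_mem _ htG g

end PermWreath

/-! ### Two generators for the wreath product of symmetric groups -/

namespace Equiv.Perm

variable {Y : Type*} [Fintype Y] [DecidableEq Y]

theorem IsCycle.apply_apply_ne {c : Perm Y} (hc : c.IsCycle) (hcs : c.support = Finset.univ)
    (h3 : 3 ≤ Fintype.card Y) (y : Y) : c (c y) ≠ y := by
  intro h
  have hy : c y ≠ y := by rw [← mem_support, hcs]; exact Finset.mem_univ _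
  have h2 : c ^ 2 = 1 := hc.pow_eq_one_iff.mpr ⟨y, hy, by rw [pow_two]; exact h⟩
  have := Nat.le_of_dvd two_pos (orderOf_dvd_of_pow_eq_one h2)
  rw [hc.orderOf, hcs, Finset.card_univ] at this
  omega

/-- With fewer than three points there are no three-cycles and the alternating group is trivial,
which is why the hypothesis is guarded. -/
theorem alternatingGroup_le_of_isThreeCycle {N : Subgroup (Perm Y)} [hN : N.Normal]
    (h : 3 ≤ Fintype.card Y → ∃ z ∈ N, z.IsThreeCycle) : alternatingGroup Y ≤ N := by
  rw [← closure_three_cycles_eq_alternating, Subgroup.closure_le]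
  intro w hw
  have hw : w.IsThreeCycle := hw
  obtain ⟨z, hzN, hz⟩ := h (hw.card_support ▸ Finset.card_le_univ _)
  obtain ⟨g, rfl⟩ := isConj_iff.mp
    ((isConj_iff_cycleType_eq (σ := z) (τ := w)).mpr (hz.trans hw.symm))
  exact hN.conj_mem _ hzN g

end Equiv.Perm

namespace PermWreath

variable {X Y : Type*} [Fintype X] [Fintype Y] [DecidableEq Y]

/-- The product of the signs of the coordinates. -/
def signProd : PermWreath (Perm Y) X →* ℤˣ where
  toFun a := ∏ j, Perm.sign (a.comp j)
  map_one' := by simp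
  map_mul' a b := by
    simp only [mul_comp, map_mul, Finset.prod_mul_distrib]
    congr 1
    exact Equiv.prod_comp a.bar fun j => Perm.sign (b.comp j)

theorem signProd_base (f : X → Perm Y) : signProd (base f) = ∏ j, Perm.sign (f j) := rfl

variable [DecidableEq X]

theorem isCycle_apply_ne {c : Perm X} (hcs : c.support = Finset.univ) (x : X) : c x ≠ x := by
  rw [← Perm.mem_support, hcs]
  exact Finset.mem_univ _

/-- The product fixes `x` and cycles the remaining points; when `X` has two points it is the
identity. -/
theorem swap_mul_pow_card_sub_one {C : Perm X} (hC : C.IsCycle) (hCs : C.support = Finset.univ)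
    (x : X) : (swap x (C x) * C) ^ (Fintype.card X - 1) = 1 := by
  have hx := isCycle_apply_ne hCs x
  by_cases h : C (C x) = x
  · have h2 : swap x (C x) * C = 1 :=
      (congrArg (swap x (C x) * ·) (hC.eq_swap_of_apply_apply_eq_self hx h)).trans
        (swap_mul_self _ _)
    rw [h2, one_pow]
  · have hD := hC.swap_mul hx h
    rw [← orderOf_dvd_iff_pow_eq_one, hD.orderOf, Perm.support_swap_mul_eq _ _ h, hCs,
      ← Finset.erase_eq, Finset.card_erase_of_mem (Finset.mem_univ _), Finset.card_univ]

/-- The bar of `y` fixes `j` and has order dividing `|X| - 1`, which is odd. So `y ^ (|X| - 1)` is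
the transposition `t` alone in coordinate `j`. -/
theorem exists_closure_pair_eq_top_of_even (hX : Even (Fintype.card X)) {C : Perm X}
    (hC : C.IsCycle) (hCs : C.support = Finset.univ) {c : Perm Y} (hc : c.IsCycle)
    (hcs : c.support = Finset.univ) :
    ∃ x y : PermWreath (Perm Y) X, Subgroup.closure {x, y} = ⊤ := by
  obtain ⟨j, hj, -⟩ := id hC
  obtain ⟨b, hb, -⟩ := id hc
  set t : Perm Y := swap b (c b) with ht
  set T : Perm X := swap j (C j) with hT
  have htt : t * t = 1 := swap_mul_self _ _
  have hDj : (T * C) j = j := by simp [hT]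
  let x : PermWreath (Perm Y) X := ⟨Pi.mulSingle j c, T⟩
  let y : PermWreath (Perm Y) X := ⟨Pi.mulSingle j t, T * C⟩
  refine ⟨x, y, ?_⟩
  set G := Subgroup.closure {x, y} with hG
  have hxG : x ∈ G := Subgroup.subset_closure (by simp)
  have hyG : y ∈ G := Subgroup.subset_closure (by simp)
  have hTG : T ∈ bars G := ⟨x, hxG, rfl⟩
  have hCG : C ∈ bars G := by
    have := (bars G).mul_mem hTG (⟨y, hyG, rfl⟩ : T * C ∈ bars G)
    rwa [← mul_assoc, hT, swap_mul_self, one_mul] at this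
  have hbars : bars G = ⊤ :=
    bars_eq_top (Perm.closure_cycle_adjacent_swap hC hCs j) hCG hTG
  have hctG : stabProj G j = ⊤ := by
    refine stabProj_eq_top (Perm.closure_cycle_adjacent_swap hc hcs b) ?_ ?_
    · exact ⟨x * x, G.mul_mem hxG hxG, by simp [x, hT], by simp [x, hT, hj]⟩
    · exact ⟨y, hyG, hDj, by simp [y, ht]⟩
  refine eq_top_of_isSwap hbars hctG (t := t) ⟨b, c b, hb.symm, rfl⟩ ?_
  have hypow : ∀ k : ℕ, (y ^ k).comp = Pi.mulSingle j (t ^ k) := by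
    intro k
    induction k with
    | zero => ext i; simp
    | succ k ih =>
      funext i
      rw [pow_succ', mul_comp, ih, pow_succ']
      by_cases hi : i = j
      · subst hi
        have : y.bar i = i := hDj
        rw [this]
        simp [y]
      · have : y.bar i ≠ j := fun h => hi ((T * C).injective (h.trans hDj.symm))
        rw [Pi.mulSingle_eq_of_ne this, Pi.mulSingle_eq_of_ne hi, mul_one]
        exact Pi.mulSingle_eq_of_ne hi _
  have hcard : 0 < Fintype.card X := Fintype.card_pos_iff.mpr ⟨j⟩
  have hodd : Odd (Fintype.card X - 1) := Nat.Even.sub_odd hcard hX odd_one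
  have hbar : (y ^ (Fintype.card X - 1)).bar = 1 := by
    rw [pow_bar]
    exact swap_mul_pow_card_sub_one hC hCs j
  have htpow : t ^ (Fintype.card X - 1) = t := by
    obtain ⟨k, hk⟩ := hodd
    rw [hk, pow_succ, pow_mul, pow_two, htt, one_pow, one_mul]
  rw [mem_coordSubgroup]
  have := G.pow_mem hyG (Fintype.card X - 1)
  rwa [← base_comp_eq hbar, hypow, htpow] at this

theorem signProd_of_comp_eq_mulSingle {a : PermWreath (Perm Y) X} {j : X} {p : Perm Y}
    (h : a.comp = Pi.mulSingle j p) : signProd a = Perm.sign p := by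
  change ∏ i, Perm.sign (a.comp i) = _
  rw [h, Finset.prod_eq_single j (fun i _ hi => by simp [hi]) (by simp)]
  simp

/-- If the coordinates of a subgroup contain the alternating groups, and the subgroup contains
base elements that are odd at `j` and at any other prescribed coordinate only, then it contains
all base elements whose product of signs is `1`. -/
theorem base_mem_of_prod_sign_eq_one {G : Subgroup (PermWreath (Perm Y) X)} {j : X}
    (hA : ∀ k, alternatingGroup Y ≤ coordSubgroup G k)
    (hw : ∀ k, k ≠ j → ∃ w, base w ∈ G ∧ Perm.sign (w j) = -1 ∧ Perm.sign (w k) = -1 ∧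
      ∀ i, i ≠ j → i ≠ k → Perm.sign (w i) = 1)
    (f : X → Perm Y) (hf : ∏ i, Perm.sign (f i) = 1) : base f ∈ G := by
  -- Induction on a set `s` of coordinates that, besides `j`, may be odd; multiplying by the `w` for
  -- `k` makes `k` even and changes the sign only at `j` otherwise.
  suffices H : ∀ s : Finset X, j ∉ s → ∀ f : X → Perm Y,
      (∀ i, i ∉ s → i ≠ j → Perm.sign (f i) = 1) → ∏ i, Perm.sign (f i) = 1 → base f ∈ G from
    H (Finset.univ.erase j) (by simp) f (by simp) hf
  intro s
  induction s using Finset.induction_on with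
  | empty =>
    intro _ f hs hf
    have hj : Perm.sign (f j) = 1 := by
      rwa [Finset.prod_eq_single j (fun i _ hi => hs i (by simp) hi) (by simp)] at hf
    refine base_mem_of_forall_mem fun i => hA i (Perm.mem_alternatingGroup.mpr ?_)
    by_cases hi : i = j
    · rw [hi, hj]
    · exact hs i (by simp) hi
  | insert k s hk ih =>
    intro hjs f hs hf
    rw [Finset.mem_insert, not_or] at hjs
    by_cases hfk : Perm.sign (f k) = 1
    · refine ih hjs.2 f (fun i hi hij => ?_) hf
      by_cases hik : i = k
      · rw [hik, hfk]
      · exact hs i (by simp [hik, hi]) hij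
    · obtain ⟨w, hwG, hwj, hwk, hwi⟩ := hw k (Ne.symm hjs.1)
      have hfk : Perm.sign (f k) = -1 := (Int.units_eq_one_or _).resolve_left hfk
      have hwprod : ∏ i, Perm.sign (w i) = 1 := by
        rw [Finset.prod_eq_mul j k hjs.1 (fun i _ hi => hwi i hi.1 hi.2) (by simp) (by simp),
          hwj, hwk]
        rfl
      have := ih hjs.2 (f * w) (fun i hi hij => ?_) ?_
      · rw [map_mul] at this
        exact (Subgroup.mul_mem_cancel_right G hwG).mp this
      · rw [Pi.mul_apply, map_mul]
        by_cases hik : i = k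
        · rw [hik, hfk, hwk]
          rfl
        · rw [hs i (by simp [hik, hi]) hij, hwi i hij hik, mul_one]
      · simp only [Pi.mul_apply, map_mul, Finset.prod_mul_distrib, hf, hwprod, mul_one]

/-- Of `c` and `swap b (c b) * c` one is odd. Both generate with the transposition, and both
conjugate it in the same way since it commutes with itself. -/
theorem exists_odd_closure_swap_eq_top {c : Perm Y} (hc : c.IsCycle)
    (hcs : c.support = Finset.univ) (b : Y) :
    ∃ p : Perm Y, Perm.sign p = -1 ∧ Subgroup.closure {p, swap b (c b)} = ⊤ ∧
      p⁻¹ * swap b (c b) * p = swap (c⁻¹ b) b := by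
  have hb := isCycle_apply_ne hcs b
  have hconj : c⁻¹ * swap b (c b) * c = swap (c⁻¹ b) b := by
    have := Equiv.swap_apply_apply c⁻¹ b (c b)
    simpa using this.symm
  have hcl := Perm.closure_cycle_adjacent_swap hc hcs b
  rcases Int.units_eq_one_or (Perm.sign c) with h | h
  · refine ⟨swap b (c b) * c, by rw [map_mul, h, Perm.sign_swap hb.symm, mul_one], ?_, ?_⟩
    · rw [eq_top_iff, ← hcl, Subgroup.closure_le]
      have ht : swap b (c b) ∈ Subgroup.closure {swap b (c b) * c, swap b (c b)} :=
        Subgroup.subset_closure (by simp)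
      have hp : swap b (c b) * c ∈ Subgroup.closure {swap b (c b) * c, swap b (c b)} :=
        Subgroup.subset_closure (by simp)
      rintro _ (rfl | rfl)
      · exact (Subgroup.mul_mem_cancel_left _ ht).mp hp
      · exact ht
    · rw [← hconj]
      simp [mul_assoc]
  · exact ⟨c, h, hcl, hconj⟩

/-- No power of `y` isolates `t` now. Instead, commutators give the alternating groups in all
coordinates, conjugates of `y * y` give pairs of odd coordinates, and `x ^ |X|` is a base element of
sign product `-1`, which supplies the missing parity. -/
theorem exists_closure_pair_eq_top_of_odd (hX : Odd (Fintype.card X)) {C : Perm X}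
    (hC : C.IsCycle) (hCs : C.support = Finset.univ) {c : Perm Y} (hc : c.IsCycle)
    (hcs : c.support = Finset.univ) :
    ∃ x y : PermWreath (Perm Y) X, Subgroup.closure {x, y} = ⊤ := by
  obtain ⟨j, hj, -⟩ := id hC
  obtain ⟨b, hb, -⟩ := id hc
  have hX3 : 3 ≤ Fintype.card X := by
    have := hC.two_le_card_support
    rw [hCs, Finset.card_univ] at this
    obtain ⟨k, hk⟩ := hX
    omega
  obtain ⟨p, hp, hpt, hconj⟩ := exists_odd_closure_swap_eq_top hc hcs b
  set t : Perm Y := swap b (c b) with ht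
  set T : Perm X := swap j (C j) with hT
  have htt : t * t = 1 := swap_mul_self _ _
  have htsign : Perm.sign t = -1 := Perm.sign_swap hb.symm
  let x : PermWreath (Perm Y) X := ⟨Pi.mulSingle j p, C⟩
  let y : PermWreath (Perm Y) X := ⟨Pi.mulSingle j t, T⟩
  refine ⟨x, y, ?_⟩
  set G := Subgroup.closure {x, y} with hG
  have hxG : x ∈ G := Subgroup.subset_closure (by simp)
  have hyG : y ∈ G := Subgroup.subset_closure (by simp)
  have hbars : bars G = ⊤ :=
    bars_eq_top (Perm.closure_cycle_adjacent_swap hC hCs j) ⟨x, hxG, rfl⟩ ⟨y, hyG, rfl⟩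
  have hstab : stabProj G j = ⊤ := by
    refine stabProj_eq_top hpt ?_ ?_
    · exact ⟨x * y, G.mul_mem hxG hyG, by simp [x, y, hT], by simp [x, y, hj]⟩
    · exact ⟨y * y, G.mul_mem hyG hyG, by simp [y, hT], by simp [y, hT, hj]⟩
  -- the square of `y` is supported on `j` and `C j`
  let u : X → Perm Y := Pi.mulSingle j t * Pi.mulSingle (C j) t
  have huG : base u ∈ G := by
    have : y * y = base u := by
      refine PermWreath.ext (funext fun i => ?_) (by simp [y, hT])
      simp only [mul_comp, base_comp, u, y, Pi.mul_apply]
      congr 1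
      simp only [Pi.mulSingle_apply, hT, swap_apply_eq_iff, swap_apply_left]
    rw [← this]
    exact G.mul_mem hyG hyG
  -- its conjugate by `x` is supported on `C j` and `C (C j)`
  let v : X → Perm Y := Pi.mulSingle (C j) (p⁻¹ * t * p) * Pi.mulSingle (C (C j)) t
  have hvG : base v ∈ G := by
    have : x⁻¹ * base u * x = base v := by
      have : x⁻¹ * base u * x = (x⁻¹ * base (Pi.mulSingle j t) * x) *
          (x⁻¹ * base (Pi.mulSingle (C j) t) * x) := by
        simp only [u, map_mul]
        group
      rw [this, conj_base_mulSingle, conj_base_mulSingle, ← map_mul]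
      simp [v, x, hj]
    rw [← this]
    exact G.mul_mem (G.mul_mem (G.inv_mem hxG) huG) hxG
  have hCCj := hC.apply_apply_ne hCs hX3 j
  -- As `|X| ≥ 3`, the supports of `u` and `v` meet only in `C j`, so the commutator lives there.
  have hcomm : u * v * u⁻¹ * v⁻¹ =
      Pi.mulSingle (C j) (t * (p⁻¹ * t * p) * t⁻¹ * (p⁻¹ * t * p)⁻¹) := by
    have hCC : C (C j) ≠ C j := fun h => hj (C.injective h)
    funext i
    simp only [u, v, Pi.mul_apply, Pi.inv_apply]
    by_cases h1 : i = C j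
    · subst h1
      simp [hj, hCC.symm]
    · by_cases h2 : i = j
      · subst h2
        simp [hj.symm, hCCj.symm]
      · simp [h1, h2]
  have hAltj : alternatingGroup Y ≤ coordSubgroup G (C j) := by
    have hstab' : (coordSubgroup G (C j)).Normal := by
      refine coordSubgroup_normal ?_
      rw [Subgroup.eq_top_iff']
      intro h
      obtain ⟨g, hg, hgj, hgh⟩ : x.comp j * h * (x.comp j)⁻¹ ∈ stabProj G j :=
        hstab ▸ Subgroup.mem_top _
      have hxi : C⁻¹ (C j) = j := by simp
      refine ⟨x⁻¹ * g * x, G.mul_mem (G.mul_mem (G.inv_mem hxG) hg) hxG, ?_, ?_⟩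
      · simp [x, hgj]
      · have : x.bar⁻¹ (C j) = j := hxi
        simp only [mul_comp, inv_comp, mul_bar, inv_bar, Perm.mul_apply, this, hgj, hgh]
        group
    refine Perm.alternatingGroup_le_of_isThreeCycle fun h3 =>
      ⟨t * (p⁻¹ * t * p) * t⁻¹ * (p⁻¹ * t * p)⁻¹, ?_, ?_⟩
    · rw [mem_coordSubgroup, ← hcomm]
      simp only [map_mul, map_inv]
      exact G.mul_mem (G.mul_mem (G.mul_mem huG hvG) (G.inv_mem huG)) (G.inv_mem hvG)
    -- The commutator of two transpositions is the square of their product; here they share exactly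
    -- the point `b`, so it is a three-cycle.
    · rw [hconj, ht, swap_inv, swap_inv, swap_comm (c⁻¹ b) b, mul_assoc]
      refine (Perm.isThreeCycle_swap_mul_swap_same hb.symm ?_ ?_).isThreeCycle_sq
      · intro h
        exact hb (by rw [Perm.eq_inv_iff_eq] at h; exact h)
      · intro h
        rw [Perm.eq_inv_iff_eq] at h
        exact hc.apply_apply_ne hcs h3 b h
  have hAlt := fun k => le_coordSubgroup hbars hAltj k
  have hpairs : ∀ k, k ≠ j → ∃ w, base w ∈ G ∧ Perm.sign (w j) = -1 ∧ Perm.sign (w k) = -1 ∧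
      ∀ i, i ≠ j → i ≠ k → Perm.sign (w i) = 1 := by
    intro k hk
    -- Conjugation by `g` keeps the odd coordinate `j` of `u` and moves the other one from `C j` to
    -- `k`.
    obtain ⟨g, hg, hgb⟩ : swap (C j) k ∈ bars G := hbars ▸ Subgroup.mem_top _
    have hmem := G.mul_mem (G.mul_mem (G.inv_mem hg) huG) hg
    rw [conj_base, hgb] at hmem
    refine ⟨_, hmem, ?_, ?_, ?_⟩
    · simp [u, swap_apply_of_ne_of_ne hj.symm hk.symm, hj.symm, htsign]
    · simp [u, hj, htsign]
    · intro i hij hik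
      have h1 : swap (C j) k i ≠ j := by
        rw [Ne, swap_apply_eq_iff, swap_apply_of_ne_of_ne hj.symm hk.symm]
        exact hij
      have h2 : swap (C j) k i ≠ C j := by
        rw [Ne, swap_apply_eq_iff, swap_apply_left]
        exact hik
      simp [u, h1, h2]
  have hxbar : (x ^ Fintype.card X).bar = 1 := by
    rw [pow_bar, ← orderOf_dvd_iff_pow_eq_one]
    change orderOf C ∣ _
    rw [hC.orderOf, hCs, Finset.card_univ]
  have hxsign : signProd (x ^ Fintype.card X) = -1 := by
    rw [map_pow, signProd_of_comp_eq_mulSingle (p := p) rfl, hp, hX.neg_one_pow]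
  have htG : t ∈ coordSubgroup G j := by
    -- The odd factor `t` makes the sign product of `x ^ |X|` equal to `1`; the power of `x` is then
    -- cancelled.
    have h1 := base_mem_of_prod_sign_eq_one hAlt hpairs
      ((x ^ Fintype.card X).comp * Pi.mulSingle j t) (by
        rw [← signProd_base, map_mul, map_mul, base_comp_eq hxbar, hxsign,
          signProd_of_comp_eq_mulSingle (base_comp _), htsign]
        rfl)
    rw [map_mul, base_comp_eq hxbar] at h1
    exact (Subgroup.mul_mem_cancel_left G (G.pow_mem hxG _)).mp h1
  exact eq_top_of_isSwap hbars hstab ⟨b, c b, hb.symm, rfl⟩ htG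

/-- The wreath product of two non-trivial finite symmetric groups is generated by two elements. -/
theorem exists_closure_pair_eq_top {m n : ℕ} (hm : 2 ≤ m) (hn : 2 ≤ n) :
    ∃ x y : PermWreath (Perm (Fin n)) (Fin m), Subgroup.closure {x, y} = ⊤ := by
  obtain ⟨m, rfl⟩ := Nat.exists_eq_add_of_le' hm
  obtain ⟨n, rfl⟩ := Nat.exists_eq_add_of_le' hn
  rcases Nat.even_or_odd (m + 2) with h | h
  · exact exists_closure_pair_eq_top_of_even (by simpa using h) isCycle_finRotate
      support_finRotate isCycle_finRotate support_finRotate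
  · exact exists_closure_pair_eq_top_of_odd (by simpa using h) isCycle_finRotate
      support_finRotate isCycle_finRotate support_finRotate

end PermWreath

/-! ### Generators of the full transformation monoid -/

namespace FullTransf

variable {X : Type*}

@[simp] theorem mul_apply (σ τ : FullTransf X) (x : X) : (σ * τ) x = τ (σ x) := rfl

@[simp] theorem one_apply (x : X) : (1 : FullTransf X) x = x := rfl

/-- A permutation as a transformation. -/
def ofPerm (σ : Perm X) : FullTransf X := fun x => σ x

@[simp] theorem ofPerm_apply (σ : Perm X) (x : X) : ofPerm σ x = σ x := rfl

end FullTransf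

section moveTo

variable {X : Type*} [DecidableEq X]

theorem moveTo_apply (a b x : X) : moveTo a b x = if x = a then b else x :=
  Function.update_apply _ _ _ _

theorem exists_perm_apply_eq {a b c d : X} (hab : a ≠ b) (hcd : c ≠ d) :
    ∃ π : Perm X, π a = c ∧ π b = d := by
  refine ⟨swap (swap a c b) d * swap a c, ?_, by simp⟩
  have : c ≠ swap a c b := by
    rw [Ne, eq_comm, swap_apply_eq_iff, swap_apply_right]
    exact hab.symm
  simp [swap_apply_of_ne_of_ne this hcd]

theorem ofPerm_conj_moveTo (π : Perm X) (a b : X) :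
    FullTransf.ofPerm π⁻¹ * moveTo a b * FullTransf.ofPerm π = moveTo (π a) (π b) := by
  funext x
  simp only [FullTransf.mul_apply, FullTransf.ofPerm_apply, moveTo_apply, Perm.inv_eq_iff_eq,
    apply_ite π, show π (π⁻¹ x) = x from π.apply_symm_apply x]

/-- The monoid of all transformations of a finite set is generated by the permutations and one
idempotent of defect one. -/
theorem FullTransf.eq_top_of_moveTo_mem [Finite X] {N : Submonoid (FullTransf X)}
    (hperm : ∀ σ : Perm X, ofPerm σ ∈ N) {a b : X} (hab : a ≠ b) (h : moveTo a b ∈ N) :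
    N = ⊤ := by
  have hmove : ∀ c d : X, c ≠ d → moveTo c d ∈ N := by
    intro c d hcd
    obtain ⟨π, rfl, rfl⟩ := exists_perm_apply_eq hab hcd
    rw [← ofPerm_conj_moveTo]
    exact N.mul_mem (N.mul_mem (hperm _) h) (hperm _)
  cases nonempty_fintype X
  -- Induction on the number of points missed by `f`.
  suffices H : ∀ k, ∀ f : FullTransf X, (Finset.univ.image f)ᶜ.card = k → f ∈ N from
    (Submonoid.eq_top_iff' N).mpr fun f => H _ f rfl
  intro k
  induction k with
  | zero =>
    intro f hf
    have hs : Function.Surjective f := by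
      rw [Finset.card_eq_zero, Finset.compl_eq_empty_iff] at hf
      intro y
      obtain ⟨x, -, hx⟩ := Finset.mem_image.mp (hf ▸ Finset.mem_univ y)
      exact ⟨x, hx⟩
    have := hperm (Equiv.ofBijective f (Finite.surjective_iff_bijective.mp hs))
    exact this
  | succ k ih =>
    intro f hf
    have hmem : ∀ (h : X → X) z, z ∈ (Finset.univ.image h)ᶜ ↔ ∀ x, h x ≠ z := by
      intro h z
      simp
    obtain ⟨c, hc⟩ : (Finset.univ.image f)ᶜ.Nonempty := Finset.card_pos.mp (by omega)
    have hcf := (hmem f c).mp hc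
    have hninj : ¬ Function.Injective f := fun hi =>
      let ⟨x, hx⟩ := Finite.surjective_of_injective hi c
      hcf x hx
    simp only [Function.Injective, not_forall] at hninj
    obtain ⟨x, y, hxy, hne⟩ := hninj
    -- `f` identifies `x` with `y` and misses `c`. Sending `x` to `c` instead lowers the defect, and
    -- `moveTo c (f y)` undoes the change.
    let g : FullTransf X := fun w => if w = x then c else f w
    have hgx : g x = c := if_pos rfl
    have hgw : ∀ w, w ≠ x → g w = f w := fun w hw => if_neg hw
    have hg : g ∈ N := by
      apply ih
      have : (Finset.univ.image g)ᶜ = (Finset.univ.image f)ᶜ.erase c := by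
        ext z
        rw [Finset.mem_erase]
        refine (hmem g z).trans (Iff.trans ?_ (and_congr_right' (hmem f z).symm))
        change (∀ w, g w ≠ z) ↔ z ≠ c ∧ ∀ w, f w ≠ z
        constructor
        · intro hz
          refine ⟨fun h => hz x (by rw [hgx, h]), fun w hw => ?_⟩
          by_cases hwx : w = x
          · exact hz y (by rw [hgw y (Ne.symm hne), ← hxy, ← hwx, hw])
          · exact hz w (by rw [hgw w hwx, hw])
        · rintro ⟨hzc, hz⟩ w hw
          by_cases hwx : w = x
          · exact hzc (by rw [← hw, hwx, hgx])
          · exact hz w (by rwa [hgw w hwx] at hw)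
      rw [this, Finset.card_erase_of_mem hc, hf]
      rfl
    have : f = g * moveTo c (f y) := by
      funext w
      rw [FullTransf.mul_apply, moveTo_apply]
      by_cases hwx : w = x
      · rw [hwx, hgx, if_pos rfl, hxy]
      · rw [hgw w hwx, if_neg (hcf w)]
    rw [this]
    exact N.mul_mem hg (hmove _ _ (hcf y).symm)

end moveTo

/-! ### Generators of the partial transformation monoid -/

namespace PartialTransf

variable {Y : Type*}

@[simp] theorem mul_apply (α β : PartialTransf Y) (y : Y) : (α * β) y =
    (α y).bind fun z => β z := rfl

@[simp] theorem one_apply (y : Y) : (1 : PartialTransf Y) y = some y := rfl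

@[simp] theorem empty_apply (y : Y) : empty Y y = none := rfl

theorem ne_empty_iff {α : PartialTransf Y} : α ≠ empty Y ↔ ∃ y z, α y = some z := by
  rw [← not_iff_not, not_not]
  simp only [not_exists, ← Option.eq_none_iff_forall_ne_some]
  exact funext_iff

/-- A transformation as a partial transformation. -/
def ofFull : FullTransf Y →* PartialTransf Y where
  toFun f := fun y => some (f y)
  map_one' := rfl
  map_mul' _ _ := rfl

@[simp] theorem ofFull_apply (f : FullTransf Y) (y : Y) : ofFull f y = some (f y) := rfl

variable [DecidableEq Y]

/-- The partial identity defined everywhere except at `a`. -/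
def omitPoint (a : Y) : PartialTransf Y := Function.update (fun y => some y) a none

theorem omitPoint_apply (a y : Y) : omitPoint a y = if y = a then none else some y :=
  Function.update_apply _ _ _ _

theorem conj_omitPoint (π : Perm Y) (a : Y) :
    ofFull (FullTransf.ofPerm π⁻¹) * omitPoint a * ofFull (FullTransf.ofPerm π) =
      omitPoint (π a) := by
  funext y
  simp only [mul_apply, ofFull_apply, FullTransf.ofPerm_apply, Option.bind_some,
    omitPoint_apply, Perm.inv_eq_iff_eq]
  split_ifs
  · rfl
  · rw [Option.bind_some, show π (π⁻¹ y) = y from π.apply_symm_apply y]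

/-- The monoid of all partial transformations of a finite set is generated by the permutations,
one total idempotent of defect one and one partial identity of defect one. -/
theorem eq_top_of_omitPoint_mem [Finite Y] {N : Submonoid (PartialTransf Y)}
    (hperm : ∀ σ : Perm Y, ofFull (FullTransf.ofPerm σ) ∈ N) {a b : Y} (hab : a ≠ b)
    (hmove : ofFull (moveTo a b) ∈ N) {c : Y} (homit : omitPoint c ∈ N) : N = ⊤ := by
  have hfull : ∀ f, ofFull f ∈ N := by
    have : N.comap ofFull = ⊤ := FullTransf.eq_top_of_moveTo_mem hperm hab hmove
    exact fun f => (this ▸ Submonoid.mem_top f : f ∈ N.comap ofFull)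
  have homit' : ∀ d, omitPoint d ∈ N := by
    intro d
    have := N.mul_mem (N.mul_mem (hperm (swap c d)⁻¹) homit) (hperm (swap c d))
    rwa [conj_omitPoint, swap_apply_left] at this
  cases nonempty_fintype Y
  suffices H : ∀ s : Finset Y, ∀ α : PartialTransf Y, (∀ y ∉ s, α y ≠ none) → α ∈ N from
    (Submonoid.eq_top_iff' N).mpr fun α => H Finset.univ α (by simp)
  intro s
  induction s using Finset.induction_on with
  | empty =>
    intro α hα
    have : ∀ y, ∃ z, α y = some z := fun y => Option.ne_none_iff_exists'.mp (hα y (by simp))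
    choose f hf using this
    have : α = ofFull f := funext hf
    exact this ▸ hfull f
  | insert y s hy ih =>
    intro α hα
    by_cases hαy : α y = none
    · let β : PartialTransf Y := fun w => if w = y then some y else α w
      have hβy : β y = some y := if_pos rfl
      have hβw : ∀ w, w ≠ y → β w = α w := fun w hw => if_neg hw
      have : α = omitPoint y * β := by
        funext w
        rw [mul_apply, omitPoint_apply]
        by_cases hwy : w = y
        · rw [hwy, hαy, if_pos rfl, Option.bind_none]
        · rw [if_neg hwy, Option.bind_some, hβw w hwy]
      rw [this]
      refine N.mul_mem (homit' y) (ih β fun w hw => ?_)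
      by_cases hwy : w = y
      · rw [hwy, hβy]
        exact Option.some_ne_none y
      · rw [hβw w hwy]
        exact hα w (by simp [hwy, hw])
    · refine ih α fun w hw => ?_
      by_cases hwy : w = y
      · rwa [hwy]
      · exact hα w (by simp [hwy, hw])

end PartialTransf

/-! ### Generators of the wreath product of monoids -/

namespace Wreath

section

variable {S X : Type*} [Monoid S]

@[simp] theorem mul_comp (a b : Wreath S X) (j : X) :
    (a * b).comp j = a.comp j * b.comp (a.bar j) := rfl

@[simp] theorem mul_bar (a b : Wreath S X) : (a * b).bar = a.bar * b.bar := rfl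

@[simp] theorem one_comp (j : X) : (1 : Wreath S X).comp j = 1 := rfl

@[simp] theorem one_bar : (1 : Wreath S X).bar = 1 := rfl

@[simp] theorem barEmb_comp (τ : FullTransf X) (j : X) : (barEmb τ : Wreath S X).comp j = 1 := rfl

@[simp] theorem barEmb_bar (τ : FullTransf X) : (barEmb τ : Wreath S X).bar = τ := rfl

/-- `τ ↦ (1, …, 1; τ)` as a homomorphism. -/
def barHom : FullTransf X →* Wreath S X where
  toFun := barEmb
  map_one' := rfl
  map_mul' _ _ := Wreath.ext (funext fun _ => (one_mul _).symm) rfl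

/-- `s ↦ (s; 1)` as a homomorphism. -/
def baseHom : (X → S) →* Wreath S X where
  toFun s := ⟨s, 1⟩
  map_one' := rfl
  map_mul' _ _ := rfl

theorem baseHom_mul_barHom (a : Wreath S X) : baseHom a.comp * barHom a.bar = a :=
  Wreath.ext (funext fun _ => mul_one _) rfl

variable [DecidableEq X]

theorem coordEmb_comp (j : X) (s : S) (i : X) :
    (coordEmb j s).comp i = if i = j then s else 1 :=
  Function.update_apply (fun _ => 1) j s i

@[simp] theorem coordEmb_bar (j : X) (s : S) : (coordEmb j s).bar = 1 := rfl

/-- `coordEmb j` as a homomorphism. -/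
def coordHom (j : X) : S →* Wreath S X := baseHom.comp (MonoidHom.mulSingle (fun _ => S) j)

theorem coordHom_apply (j : X) (s : S) : coordHom j s = coordEmb j s := rfl

theorem conj_coordEmb (π : Perm X) (j : X) (s : S) :
    barEmb (FullTransf.ofPerm π) * coordEmb (π j) s * barEmb (FullTransf.ofPerm π⁻¹) =
      coordEmb j s :=
  Wreath.ext (funext fun i => by simp [coordEmb_comp]) (funext fun i => by simp)

theorem eq_top_of_coordEmb_mem [Finite X] {N : Submonoid (Wreath S X)}
    (hbar : ∀ τ, barEmb τ ∈ N) {j : X} (hcoord : ∀ s, coordEmb j s ∈ N) : N = ⊤ := by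
  rw [Submonoid.eq_top_iff']
  intro a
  rw [← baseHom_mul_barHom a]
  refine N.mul_mem ?_ (hbar _)
  refine Submonoid.pi_mem_of_mulSingle_mem (H := N.comap baseHom) a.comp fun k => ?_
  have := N.mul_mem (N.mul_mem (hbar (FullTransf.ofPerm (swap k j))) (hcoord (a.comp k)))
    (hbar (FullTransf.ofPerm (swap k j)⁻¹))
  have h2 := conj_coordEmb (swap k j) k (a.comp k)
  rw [swap_apply_left] at h2
  rw [h2] at this
  exact this

end

variable {X Y : Type*}

/-- The inclusion of the group of units. -/
def ofPermWreath : PermWreath (Perm Y) X →* Wreath (PartialTransf Y) X where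
  -- The inverse reconciles composition in `Perm Y`, right factor first, with that of partial maps,
  -- left factor first.
  toFun a := ⟨fun j => PartialTransf.ofFull (FullTransf.ofPerm (a.comp j)⁻¹),
    FullTransf.ofPerm a.bar⟩
  map_one' := rfl
  map_mul' a b := Wreath.ext
    (funext fun j => funext fun y => by simp) rfl

theorem ofPermWreath_comp (a : PermWreath (Perm Y) X) (j : X) :
    (ofPermWreath a).comp j = PartialTransf.ofFull (FullTransf.ofPerm (a.comp j)⁻¹) := rfl

theorem ofPermWreath_bar (a : PermWreath (Perm Y) X) :
    (ofPermWreath a).bar = FullTransf.ofPerm a.bar := rfl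

theorem eq_top_of_mem [Finite X] [Finite Y] [DecidableEq X] [DecidableEq Y]
    {N : Submonoid (Wreath (PartialTransf Y) X)} (hunit : ∀ a, ofPermWreath a ∈ N)
    {i j : X} (hij : i ≠ j) (hbar : barEmb (moveTo i j) ∈ N) {k : X} {a b : Y} (hab : a ≠ b)
    (hmove : coordEmb k (PartialTransf.ofFull (moveTo a b)) ∈ N) {c : Y}
    (homit : coordEmb k (PartialTransf.omitPoint c) ∈ N) : N = ⊤ := by
  have h1 : N.comap barHom = ⊤ := by
    refine FullTransf.eq_top_of_moveTo_mem (fun σ => ?_) hij hbar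
    have := hunit ⟨fun _ => 1, σ⟩
    exact this
  have h2 : N.comap (coordHom k) = ⊤ := by
    refine PartialTransf.eq_top_of_omitPoint_mem (fun σ => ?_) hab hmove homit
    have : ofPermWreath ⟨Pi.mulSingle k σ⁻¹, 1⟩ = coordHom k
        (PartialTransf.ofFull (FullTransf.ofPerm σ)) := by
      refine Wreath.ext (funext fun l => ?_) rfl
      rw [coordHom_apply, coordEmb_comp]
      by_cases hl : l = k
      · subst hl
        simp [ofPermWreath_comp]
      · simp only [ofPermWreath_comp, if_neg hl, Pi.mulSingle_eq_of_ne hl]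
        rfl
    exact Submonoid.mem_comap.mpr (this ▸ hunit _)
  exact eq_top_of_coordEmb_mem
    (fun τ => (h1 ▸ Submonoid.mem_top τ : τ ∈ N.comap barHom))
    (fun s => (h2 ▸ Submonoid.mem_top s : s ∈ N.comap (coordHom k)))

end Wreath

/-! ### Coordinates on `Ω` and the action of the wreath product -/

/-- Identifications of `Ω` with `X × Y` for which `E` is equality of the first coordinates. -/
def IsCoordinates {Ω X Y : Type*} (E : Setoid Ω) (e : Ω ≃ X × Y) : Prop :=
  ∀ x y, E x y ↔ (e x).1 = (e y).1

theorem IsUniformEquiv.exists_isCoordinates {Ω : Type*} [Finite Ω] {E : Setoid Ω} {m n : ℕ}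
    (hE : IsUniformEquiv E m n) : ∃ e : Ω ≃ Fin m × Fin n, IsCoordinates E e := by
  have hq : Nat.card (Quotient E) = m := by
    rw [Nat.card_congr E.quotientEquivClasses, Nat.card_coe_set_eq, hE.ncard_classes]
  have hfib : ∀ q : Quotient E, Nat.card {x // Quotient.mk E x = q} = n := by
    intro q
    induction q using Quotient.inductionOn with
    | h a =>
      rw [← hE.ncard_class _ (E.mem_classes a), ← Nat.card_coe_set_eq]
      exact Nat.card_congr (Equiv.subtypeEquivRight fun x => Quotient.eq)
  let eq : Quotient E ≃ Fin m := Finite.equivFinOfCardEq hq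
  let ef : ∀ q : Quotient E, {x // Quotient.mk E x = q} ≃ Fin n :=
    fun q => Finite.equivFinOfCardEq (hfib q)
  refine ⟨(Equiv.sigmaFiberEquiv (Quotient.mk E)).symm.trans
    ((Equiv.sigmaEquivProdOfEquiv ef).trans (eq.prodCongr (Equiv.refl _))), fun x y => ?_⟩
  refine (Quotient.eq (r := E)).symm.trans ?_
  exact eq.injective.eq_iff.symm

namespace Wreath

variable {Ω X Y : Type*} {E : Setoid Ω} {e : Ω ≃ X × Y}

/-- The action of the wreath product on `Ω`, in coordinates. -/
def toPTE (he : IsCoordinates E e) : Wreath (PartialTransf Y) X →* PTE E where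
  toFun w := ⟨fun ω => (w.comp (e ω).1 (e ω).2).map fun z => e.symm (w.bar (e ω).1, z), by
    intro x y x' y' hx hy h
    obtain ⟨a, -, rfl⟩ := Option.map_eq_some_iff.mp hx
    obtain ⟨b, -, rfl⟩ := Option.map_eq_some_iff.mp hy
    rw [he] at h ⊢
    simp [h]⟩
  map_one' := Subtype.ext <| funext fun ω => by
    change some (e.symm ((e ω).1, (e ω).2)) = some ω
    simp
  map_mul' v w := Subtype.ext <| funext fun ω => by
    change ((v.comp (e ω).1 (e ω).2).bind fun z => w.comp (v.bar (e ω).1) z).map _ =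
      ((v.comp (e ω).1 (e ω).2).map _).bind _
    cases v.comp (e ω).1 (e ω).2 <;> simp

theorem toPTE_apply (he : IsCoordinates E e) (w : Wreath (PartialTransf Y) X) (j : X) (y : Y) :
    (toPTE he w).1 (e.symm (j, y)) = (w.comp j y).map fun z => e.symm (w.bar j, z) := by
  change (w.comp (e (e.symm (j, y))).1 (e (e.symm (j, y))).2).map _ = _
  simp

theorem toPTE_surjective (he : IsCoordinates E e) : Function.Surjective (toPTE he) := by
  intro α
  have hbar : ∀ j : X, ∃ k : X, ∀ y ω, α.1 (e.symm (j, y)) = some ω → (e ω).1 = k := by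
    intro j
    by_cases h : ∃ y ω, α.1 (e.symm (j, y)) = some ω
    · obtain ⟨y, ω, hy⟩ := h
      refine ⟨(e ω).1, fun y' ω' hy' => ?_⟩
      rw [← he]
      exact α.2 _ _ _ _ hy' hy ((he _ _).mpr (by simp))
    -- On a class disjoint from the domain the target is arbitrary.
    · exact ⟨j, fun y ω hy => absurd ⟨y, ω, hy⟩ h⟩
  choose σ hσ using hbar
  refine ⟨⟨fun j y => (α.1 (e.symm (j, y))).map fun ω => (e ω).2, σ⟩,
    Subtype.ext (funext fun ω => ?_)⟩
  obtain ⟨⟨j, y⟩, rfl⟩ := e.symm.surjective ω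
  rw [toPTE_apply]
  cases h : α.1 (e.symm (j, y)) with
  | none => simp [h]
  | some ω =>
    simp only [h, Option.map_some, Option.some.injEq]
    rw [← hσ j y ω h]
    simp

theorem toPTE_eq_iff (he : IsCoordinates E e) {v w : Wreath (PartialTransf Y) X} :
    toPTE he v = toPTE he w ↔
      v.comp = w.comp ∧ ∀ j, v.comp j ≠ PartialTransf.empty Y → v.bar j = w.bar j := by
  have key : toPTE he v = toPTE he w ↔ ∀ j y,
      ((v.comp j y).map fun z => e.symm (v.bar j, z)) =
        (w.comp j y).map fun z => e.symm (w.bar j, z) := by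
    simp only [← toPTE_apply he]
    constructor
    · rintro h j y
      rw [h]
    · intro h
      refine Subtype.ext (funext fun ω => ?_)
      obtain ⟨⟨j, y⟩, rfl⟩ := e.symm.surjective ω
      exact h j y
  rw [key]
  constructor
  · intro h
    have hcomp : ∀ j y, v.comp j y = w.comp j y := by
      intro j y
      have := congrArg (Option.map fun ω => (e ω).2) (h j y)
      simpa [Option.map_map, Function.comp_def] using this
    refine ⟨funext fun j => funext fun y => hcomp j y, fun j hj => ?_⟩
    obtain ⟨y, z, hz⟩ := PartialTransf.ne_empty_iff.mp hj
    have := h j y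
    rw [← hcomp, hz] at this
    simpa using this
  · rintro ⟨hcomp, hbar⟩ j y
    rw [← hcomp]
    cases hz : v.comp j y with
    | none => rfl
    | some z => rw [hbar j (PartialTransf.ne_empty_iff.mpr ⟨y, z, hz⟩)]

/-! ### The kernel of the action -/

section Congruence

variable [DecidableEq X]

/-- The block of an empty coordinate may be redirected to the image of any other block. -/
theorem pairCon_update_apply {j k : X} (hjk : j ≠ k) {i l : X} (hil : i ≠ l)
    {s : X → PartialTransf Y} (hs : s i = PartialTransf.empty Y) (σ : FullTransf X) :
    pairCon (coordEmb j (PartialTransf.empty Y))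
      (coordEmb j (PartialTransf.empty Y) * barEmb (moveTo j k))
      ⟨s, σ⟩ ⟨s, fun x => if x = i then σ l else σ x⟩ := by
  obtain ⟨π, rfl, rfl⟩ := exists_perm_apply_eq hil hjk
  set R := pairCon (coordEmb (π i) (PartialTransf.empty Y))
      (coordEmb (π i) (PartialTransf.empty Y) * barEmb (moveTo (π i) (π l))) with hR
  have h0 : R (coordEmb (π i) (PartialTransf.empty Y))
      (coordEmb (π i) (PartialTransf.empty Y) * barEmb (moveTo (π i) (π l))) :=
    ConGen.Rel.of _ _ ⟨rfl, rfl⟩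
  -- Between these factors the pair's transformation sends `i` to `π i`, then `π l`, then `l`, then
  -- `σ l`; other points just follow `σ`.
  have h1 := R.mul (R.mul (R.refl ⟨s, FullTransf.ofPerm π⟩) h0)
    (R.refl ⟨fun _ => 1, FullTransf.ofPerm π⁻¹ * σ⟩)
  have hcomp : ∀ x, s x * (if x = i then PartialTransf.empty Y else 1) = s x := by
    intro x
    split_ifs with hx
    · rw [hx, hs]
      rfl
    · rw [mul_one]
  convert h1 using 1
  · refine Wreath.ext (funext fun x => ?_) (funext fun x => ?_)
    · simp [coordEmb_comp, hcomp]
    · simp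
  · refine Wreath.ext (funext fun x => ?_) (funext fun x => ?_)
    · simp [coordEmb_comp, hcomp]
    · simp only [mul_bar, coordEmb_bar, barEmb_bar, FullTransf.mul_apply, FullTransf.one_apply,
        FullTransf.ofPerm_apply, moveTo_apply, π.injective.eq_iff]
      split_ifs <;> simp

theorem pairCon_of_eq_of_ne [Finite X] {j k : X} (hjk : j ≠ k) {s : X → PartialTransf Y}
    {σ τ : FullTransf X} (h : ∀ i, s i ≠ PartialTransf.empty Y → σ i = τ i) :
    pairCon (coordEmb j (PartialTransf.empty Y))
      (coordEmb j (PartialTransf.empty Y) * barEmb (moveTo j k)) ⟨s, σ⟩ ⟨s, τ⟩ := by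
  set R := pairCon (coordEmb j (PartialTransf.empty Y))
      (coordEmb j (PartialTransf.empty Y) * barEmb (moveTo j k))
  have hstep : ∀ i, s i = PartialTransf.empty Y → ∀ (σ : FullTransf X) (x : X),
      R ⟨s, σ⟩ ⟨s, fun y => if y = i then x else σ y⟩ := by
    intro i hi σ x
    obtain ⟨l, hil⟩ : ∃ l, i ≠ l := by
      by_cases hij : i = j
      · exact ⟨k, hij ▸ hjk⟩
      · exact ⟨j, hij⟩
    -- Both sides are related to the element whose bar takes the value `σ l` at `i`; as `l ≠ i`,
    -- changing the bar at `i` leaves its value at `l` alone.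
    have h1 := pairCon_update_apply hjk hil hi σ
    have h2 := pairCon_update_apply hjk hil hi (fun y => if y = i then x else σ y)
    refine R.trans h1 (R.symm ?_)
    convert h2 using 1
    refine Wreath.ext rfl (funext fun y => ?_)
    by_cases hy : y = i <;> simp [hy, hil.symm]
  cases nonempty_fintype X
  suffices H : ∀ t : Finset X, ∀ σ : FullTransf X, (∀ i ∉ t, σ i = τ i) →
      (∀ i ∈ t, s i = PartialTransf.empty Y) → R ⟨s, σ⟩ ⟨s, τ⟩ by
    classical
    refine H (Finset.univ.filter fun i => s i = PartialTransf.empty Y) σ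
      (fun i hi => h i (by simpa using hi)) (fun i hi => by simpa using hi)
  intro t
  induction t using Finset.induction_on with
  | empty =>
    intro σ hσ _
    have : σ = τ := funext fun i => hσ i (by simp)
    rw [this]
    exact R.refl _
  | insert i t hi ih =>
    intro σ hσ ht
    refine R.trans (hstep i (ht i (by simp)) σ (τ i)) (ih _ (fun l hl => ?_) fun l hl =>
      ht l (by simp [hl]))
    by_cases hli : l = i
    · simp [hli]
    · simpa [hli] using hσ l (by simp [hli, hl])

/-- The kernel of the action on `Ω` is generated by a single pair. -/
theorem ker_toPTE [Finite X] (he : IsCoordinates E e) {j k : X} (hjk : j ≠ k) :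
    Con.ker (toPTE he) = pairCon (coordEmb j (PartialTransf.empty Y))
      (coordEmb j (PartialTransf.empty Y) * barEmb (moveTo j k)) := by
  refine le_antisymm (fun v w hvw => ?_) (Con.conGen_le.mpr ?_)
  · obtain ⟨hcomp, hbar⟩ := (toPTE_eq_iff he).mp (Con.ker_rel _ |>.mp hvw)
    obtain ⟨s, σ⟩ := v
    obtain ⟨t, τ⟩ := w
    obtain rfl : s = t := hcomp
    exact pairCon_of_eq_of_ne hjk hbar
  · rintro v w ⟨rfl, rfl⟩
    refine (Con.ker_rel _).mpr ((toPTE_eq_iff he).mpr ⟨funext fun i => by simp, fun i hi => ?_⟩)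
    have hij : i ≠ j := by
      rintro rfl
      exact hi (by simp [coordEmb_comp])
    simp [moveTo_apply, hij]

end Congruence

/-! ### The cardinality -/

section Card

/-- One representative of every class of the kernel of the action on `Ω`. -/
def ofOption (j₀ : X) (q : X → Option (X × {s : PartialTransf Y // s ≠ PartialTransf.empty Y})) :
    Wreath (PartialTransf Y) X :=
  ⟨fun j => (q j).elim (PartialTransf.empty Y) fun p => p.2.1, fun j => (q j).elim j₀ fun p => p.1⟩

/-- `none` encodes an empty component, whose irrelevant target is normalised to `j₀`. -/
theorem bijective_toPTE_ofOption (he : IsCoordinates E e) (j₀ : X) :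
    Function.Bijective fun q => toPTE he (ofOption (Y := Y) j₀ q) := by
  constructor
  · intro q r h
    obtain ⟨hcomp, hbar⟩ := (toPTE_eq_iff he).mp h
    funext j
    have hc := congrFun hcomp j
    have hb := hbar j
    simp only [ofOption] at hc hb
    rcases hq : q j with _ | ⟨a, s, hs⟩ <;> rcases hr : r j with _ | ⟨b, t, ht⟩ <;>
      simp only [hq, hr, Option.elim_none, Option.elim_some] at hc hb
    · rfl
    · exact absurd hc.symm ht
    · exact absurd hc hs
    · obtain rfl : s = t := hc
      obtain rfl : a = b := hb hs
      rfl
  · intro α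
    obtain ⟨w, rfl⟩ := toPTE_surjective he α
    classical
    refine ⟨fun j => if h : w.comp j = PartialTransf.empty Y then none
      else some (w.bar j, ⟨w.comp j, h⟩), ?_⟩
    refine (toPTE_eq_iff he).mpr ⟨funext fun j => ?_, fun j => ?_⟩
    · by_cases h : w.comp j = PartialTransf.empty Y <;> simp [ofOption, h]
    · by_cases h : w.comp j = PartialTransf.empty Y <;> simp [ofOption, h]

theorem card_PTE [Finite X] [Finite Y] (he : IsCoordinates E e) (j₀ : X) :
    (Nat.card (PTE E) : ℤ) = ((Nat.card X : ℤ) * ((Nat.card Y : ℤ) + 1) ^ Nat.card Y -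
      (Nat.card X : ℤ) + 1) ^ Nat.card X := by
  rw [← Nat.card_congr (Equiv.ofBijective _ (bijective_toPTE_ofOption he j₀))]
  cases nonempty_fintype X
  cases nonempty_fintype Y
  classical
  have hfin : Finite (PartialTransf Y) := inferInstanceAs (Finite (Y → Option Y))
  cases nonempty_fintype (PartialTransf Y)
  have hPT : Fintype.card (PartialTransf Y) = (Fintype.card Y + 1) ^ Fintype.card Y := by
    rw [← Nat.card_eq_fintype_card]
    change Nat.card (Y → Option Y) = _
    rw [Nat.card_eq_fintype_card, Fintype.card_fun, Fintype.card_option]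
  have hpos : 1 ≤ (Fintype.card Y + 1) ^ Fintype.card Y := Nat.one_le_pow _ _ (by omega)
  simp only [Nat.card_eq_fintype_card, Fintype.card_fun, Fintype.card_option, Fintype.card_prod,
    Fintype.card_subtype_compl, Fintype.card_subtype_eq, hPT]
  push_cast [Nat.cast_sub hpos]
  ring

end Card

end Wreath

/-! ### What every generating set must contain -/

section Generators

variable {M : Type*} [Monoid M] {X : Set M}

/-- A generating set contains a non-unit with a property that holds for `1`, is multiplicative and
passes to left factors, as soon as some non-unit has the property. -/
theorem exists_mem_not_isUnit (hX : Submonoid.closure X = ⊤) {P : M → Prop} (hone : P 1)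
    (hmul : ∀ a b, P a → P b → P (a * b)) (hleft : ∀ a b, P (a * b) → P a) {a : M} (ha : P a)
    (hau : ¬ IsUnit a) : ∃ x ∈ X, P x ∧ ¬ IsUnit x := by
  by_contra! H
  refine hau (Submonoid.dense_induction (motive := fun a => P a → IsUnit a) X hX H
    (fun _ => isUnit_one) (fun x y hx hy hxy => ?_) a ha)
  obtain ⟨u, rfl⟩ := hx (hleft _ _ hxy)
  refine u.isUnit.mul (hy ?_)
  -- `P` holds for `u⁻¹`, a left factor of `1`, hence for `y = u⁻¹ (u y)`.
  rw [← u.inv_mul_cancel_left y]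
  exact hmul _ _ (hleft _ (u : M) (by rwa [Units.inv_mul])) hxy

/-- A generating set contains two units if the units do not commute and their complement is an
ideal. -/
theorem exists_mem_isUnit_ne (hX : Submonoid.closure X = ⊤)
    (hleft : ∀ a b : M, IsUnit (a * b) → IsUnit a) {u v : M} (hu : IsUnit u) (hv : IsUnit v)
    (huv : u * v ≠ v * u) : ∃ x ∈ X, ∃ y ∈ X, IsUnit x ∧ IsUnit y ∧ x ≠ y := by
  by_contra! H
  -- If `X` has at most one unit, every unit is a power of it; `1` stands in when there is none.
  obtain ⟨g, hg⟩ : ∃ g : M, ∀ x ∈ X, IsUnit x → x = g := by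
    by_cases h : ∃ g ∈ X, IsUnit g
    · obtain ⟨g, hgX, hg⟩ := h
      exact ⟨g, fun x hx hxu => H x hx g hgX hxu hg⟩
    · exact ⟨1, fun x hx hxu => absurd ⟨x, hx, hxu⟩ h⟩
  have key : ∀ a, IsUnit a → a ∈ Submonoid.powers g := by
    intro a
    refine Submonoid.dense_induction (motive := fun a => IsUnit a → a ∈ Submonoid.powers g) X hX
      (fun x hx hxu => hg x hx hxu ▸ Submonoid.mem_powers g) (fun _ => one_mem _)
      (fun x y hx hy hxy => ?_) a
    have hxu := hleft x y hxy
    refine mul_mem (hx hxu) (hy ?_)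
    obtain ⟨w, rfl⟩ := hxu
    exact (Units.isUnit_units_mul w y).mp hxy
  obtain ⟨k, rfl⟩ := Submonoid.mem_powers_iff _ _ |>.mp (key u hu)
  obtain ⟨l, rfl⟩ := Submonoid.mem_powers_iff _ _ |>.mp (key v hv)
  exact huv ((Commute.refl g).pow_pow k l)

end Generators

namespace PTE

variable {Ω : Type*} {E : Setoid Ω}

/-- Everywhere defined. -/
def IsTotal (α : PTE E) : Prop := ∃ f : Ω → Ω, ∀ x, α.1 x = some (f x)

/-- Everywhere defined, and injective on every class. -/
def IsTotalInj (α : PTE E) : Prop :=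
  ∃ f : Ω → Ω, (∀ x, α.1 x = some (f x)) ∧ ∀ x y, E x y → f x = f y → x = y

/-- Everywhere defined, and mapping different classes into different classes. -/
def IsTotalSep (α : PTE E) : Prop :=
  ∃ f : Ω → Ω, (∀ x, α.1 x = some (f x)) ∧ ∀ x y, E (f x) (f y) → E x y

theorem mul_apply (α β : PTE E) (x : Ω) : (α * β).1 x = (α.1 x).bind fun z => β.1 z := rfl

theorem mul_apply_of_eq {α β : PTE E} {f g : Ω → Ω} (hf : ∀ x, α.1 x = some (f x))
    (hg : ∀ x, β.1 x = some (g x)) (x : Ω) : (α * β).1 x = some (g (f x)) := by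
  rw [mul_apply, hf, Option.bind_some, hg]

theorem exists_of_mul_eq {α β : PTE E} {h : Ω → Ω} (hh : ∀ x, (α * β).1 x = some (h x)) :
    ∃ f : Ω → Ω, (∀ x, α.1 x = some (f x)) ∧ ∀ x, β.1 (f x) = some (h x) := by
  have : ∀ x, ∃ y, α.1 x = some y ∧ β.1 y = some (h x) := fun x =>
    Option.bind_eq_some_iff.mp (hh x)
  choose f hf using this
  exact ⟨f, fun x => (hf x).1, fun x => (hf x).2⟩

theorem IsTotal.mul {α β : PTE E} : IsTotal α → IsTotal β → IsTotal (α * β) := by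
  rintro ⟨f, hf⟩ ⟨g, hg⟩
  exact ⟨fun x => g (f x), mul_apply_of_eq hf hg⟩

theorem IsTotalInj.isTotal {α : PTE E} : IsTotalInj α → IsTotal α := fun ⟨f, hf, _⟩ => ⟨f, hf⟩

theorem IsTotalSep.isTotal {α : PTE E} : IsTotalSep α → IsTotal α := fun ⟨f, hf, _⟩ => ⟨f, hf⟩

theorem isTotalInj_one : IsTotalInj (1 : PTE E) := ⟨id, fun _ => rfl, fun _ _ _ h => h⟩

theorem isTotalSep_one : IsTotalSep (1 : PTE E) := ⟨id, fun _ => rfl, fun _ _ h => h⟩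

theorem IsTotalInj.mul {α β : PTE E} : IsTotalInj α → IsTotalInj β → IsTotalInj (α * β) := by
  rintro ⟨f, hf, hfi⟩ ⟨g, hg, hgi⟩
  exact ⟨fun x => g (f x), mul_apply_of_eq hf hg, fun x y hxy h =>
    hfi x y hxy (hgi _ _ (α.2 x y _ _ (hf x) (hf y) hxy) h)⟩

theorem IsTotalSep.mul {α β : PTE E} : IsTotalSep α → IsTotalSep β → IsTotalSep (α * β) := by
  rintro ⟨f, hf, hfs⟩ ⟨g, hg, hgs⟩
  exact ⟨fun x => g (f x), mul_apply_of_eq hf hg, fun x y h => hfs x y (hgs _ _ h)⟩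

theorem IsTotalInj.of_mul {α β : PTE E} : IsTotalInj (α * β) → IsTotalInj α := by
  rintro ⟨h, hh, hhi⟩
  obtain ⟨f, hf, hfh⟩ := exists_of_mul_eq hh
  refine ⟨f, hf, fun x y hxy hfxy => hhi x y hxy (Option.some.inj ?_)⟩
  rw [← hfh, ← hfh, hfxy]

/-- The right factor preserves `E`, so it cannot separate classes that the left factor has merged.
-/
theorem IsTotalSep.of_mul {α β : PTE E} : IsTotalSep (α * β) → IsTotalSep α := by
  rintro ⟨h, hh, hhs⟩
  obtain ⟨f, hf, hfh⟩ := exists_of_mul_eq hh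
  exact ⟨f, hf, fun x y hxy => hhs x y (β.2 _ _ _ _ (hfh x) (hfh y) hxy)⟩

/-- Injectivity on classes and separation of classes give injectivity, hence bijectivity on a finite
set; separation also says that the inverse preserves `E`. -/
theorem isUnit_iff [Finite Ω] {α : PTE E} : IsUnit α ↔ IsTotalInj α ∧ IsTotalSep α := by
  constructor
  · rintro ⟨u, rfl⟩
    exact ⟨.of_mul (β := (↑u⁻¹ : PTE E)) (by rw [u.mul_inv]; exact isTotalInj_one),
      .of_mul (β := (↑u⁻¹ : PTE E)) (by rw [u.mul_inv]; exact isTotalSep_one)⟩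
  · rintro ⟨⟨f, hf, hfi⟩, ⟨g, hg, hgs⟩⟩
    obtain rfl : f = g := funext fun x => Option.some.inj ((hf x).symm.trans (hg x))
    have hinj : Function.Injective f := fun x y h => hfi x y (hgs x y (h ▸ E.refl _)) h
    let φ : Ω ≃ Ω := Equiv.ofBijective f (Finite.injective_iff_bijective.mp hinj)
    have hφ : ∀ x, f (φ.symm x) = x := φ.apply_symm_apply
    let β : PTE E := ⟨fun x => some (φ.symm x), by
      intro x y x' y' hx hy hxy
      obtain rfl := Option.some.inj hx
      obtain rfl := Option.some.inj hy
      exact hgs _ _ (by rwa [hφ, hφ])⟩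
    refine ⟨⟨α, β, Subtype.ext (funext fun x => ?_), Subtype.ext (funext fun x => ?_)⟩, rfl⟩
    · rw [mul_apply_of_eq hf (g := φ.symm) (fun _ => rfl)]
      exact congrArg some (φ.symm_apply_apply x)
    · rw [mul_apply_of_eq (f := φ.symm) (fun _ => rfl) hf]
      exact congrArg some (hφ x)

end PTE

/-! ### The rank -/

namespace Wreath

variable {Ω X Y : Type*} {E : Setoid Ω} {e : Ω ≃ X × Y}

theorem toPTE_eq_some (he : IsCoordinates E e) {w : Wreath (PartialTransf Y) X} {f : X → Y → Y}
    (hf : ∀ j y, w.comp j y = some (f j y)) (ω : Ω) :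
    (toPTE he w).1 ω = some (e.symm (w.bar (e ω).1, f (e ω).1 (e ω).2)) := by
  obtain ⟨⟨j, y⟩, rfl⟩ := e.symm.surjective ω
  rw [toPTE_apply, hf, e.apply_symm_apply]
  rfl

theorem isTotalInj_toPTE (he : IsCoordinates E e) {w : Wreath (PartialTransf Y) X}
    {f : X → Y → Y} (hf : ∀ j y, w.comp j y = some (f j y))
    (hinj : ∀ j, Function.Injective (f j)) : PTE.IsTotalInj (toPTE he w) := by
  refine ⟨_, toPTE_eq_some he hf, fun x y hxy h => ?_⟩
  rw [he] at hxy
  rw [e.symm.injective.eq_iff, Prod.mk.injEq, hxy] at h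
  exact e.injective (Prod.ext hxy (hinj _ h.2))

theorem isTotalSep_toPTE (he : IsCoordinates E e) {w : Wreath (PartialTransf Y) X}
    {f : X → Y → Y} (hf : ∀ j y, w.comp j y = some (f j y))
    (hinj : Function.Injective w.bar) : PTE.IsTotalSep (toPTE he w) := by
  refine ⟨_, toPTE_eq_some he hf, fun x y h => ?_⟩
  rw [he] at h ⊢
  simp only [e.apply_symm_apply] at h
  exact hinj h

theorem not_isTotalInj_toPTE (he : IsCoordinates E e) {w : Wreath (PartialTransf Y) X} {j : X}
    {a b : Y} (hab : a ≠ b) (h : w.comp j a = w.comp j b) : ¬ PTE.IsTotalInj (toPTE he w) := by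
  rintro ⟨f, hf, hfi⟩
  have ha := hf (e.symm (j, a))
  have hb := hf (e.symm (j, b))
  rw [toPTE_apply, h, ← toPTE_apply he, hb] at ha
  have := hfi _ _ ((he _ _).mpr (by simp)) (Option.some.inj ha.symm)
  exact hab (by simpa using this)

theorem not_isTotalSep_toPTE [Nonempty Y] (he : IsCoordinates E e)
    {w : Wreath (PartialTransf Y) X} {i j : X} (hij : i ≠ j) (h : w.bar i = w.bar j) :
    ¬ PTE.IsTotalSep (toPTE he w) := by
  rintro ⟨f, hf, hfs⟩
  obtain ⟨y⟩ := ‹Nonempty Y›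
  have key : ∀ k, (e (f (e.symm (k, y)))).1 = w.bar k := by
    intro k
    have hk := hf (e.symm (k, y))
    rw [toPTE_apply] at hk
    obtain ⟨z, -, hz⟩ := Option.map_eq_some_iff.mp hk
    rw [← hz, e.apply_symm_apply]
  have := hfs (e.symm (i, y)) (e.symm (j, y)) ((he _ _).mpr (by rw [key, key, h]))
  rw [he] at this
  exact hij (by simpa using this)

theorem not_isTotal_toPTE (he : IsCoordinates E e) {w : Wreath (PartialTransf Y) X} {j : X} {y : Y}
    (h : w.comp j y = none) : ¬ PTE.IsTotal (toPTE he w) := by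
  rintro ⟨f, hf⟩
  have := hf (e.symm (j, y))
  rw [toPTE_apply, h] at this
  simp at this

theorem isUnit_toPTE_ofPermWreath (he : IsCoordinates E e) (a : PermWreath (Perm Y) X) :
    IsUnit (toPTE he (ofPermWreath a)) :=
  ((Group.isUnit a).map ofPermWreath).map (toPTE he)

variable [DecidableEq X] [DecidableEq Y]

/-- Exchanging two classes does not commute with transposing two points inside one of them. -/
theorem exists_isUnit_mul_ne (he : IsCoordinates E e) {i j : X} (hij : i ≠ j) {a b : Y}
    (hab : a ≠ b) : ∃ u v : PTE E, IsUnit u ∧ IsUnit v ∧ u * v ≠ v * u := by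
  refine ⟨_, _, isUnit_toPTE_ofPermWreath he ⟨fun _ => 1, swap i j⟩,
    isUnit_toPTE_ofPermWreath he ⟨Pi.mulSingle i (swap a b), 1⟩, fun h => ?_⟩
  rw [← map_mul, ← map_mul, ← map_mul, ← map_mul, toPTE_eq_iff] at h
  have h1 := congrFun (congrFun h.1 i) a
  simp [ofPermWreath_comp, ofPermWreath_bar, hij.symm] at h1
  exact hab h1

/-- The non-units `p` and `q` differ because an element of both kinds is a unit; `r` differs from
all the others because it is not total. -/
theorem five_le_encard [Finite Ω] (he : IsCoordinates E e) {i j : X} (hij : i ≠ j) {a b : Y}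
    (hab : a ≠ b) {S : Set (PTE E)} (hS : Submonoid.closure S = ⊤) : 5 ≤ S.encard := by
  have : Nonempty Y := ⟨a⟩
  obtain ⟨u, v, hu, hv, huv⟩ := exists_isUnit_mul_ne he hij hab
  obtain ⟨x, hxS, y, hyS, hx, hy, hxy⟩ := exists_mem_isUnit_ne hS (fun α β h => by
    rw [PTE.isUnit_iff] at h ⊢
    exact ⟨h.1.of_mul, h.2.of_mul⟩) hu hv huv
  obtain ⟨p, hpS, hp, hpu⟩ := exists_mem_not_isUnit hS PTE.isTotalInj_one
    (fun _ _ => PTE.IsTotalInj.mul) (fun _ _ => PTE.IsTotalInj.of_mul)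
    (a := toPTE he (barEmb (moveTo i j)))
    (isTotalInj_toPTE he (f := fun _ y => y) (fun _ _ => rfl) fun _ => Function.injective_id)
    (fun h => not_isTotalSep_toPTE he hij (by simp [moveTo_apply]) (PTE.isUnit_iff.mp h).2)
  obtain ⟨q, hqS, hq, hqu⟩ := exists_mem_not_isUnit hS PTE.isTotalSep_one
    (fun _ _ => PTE.IsTotalSep.mul) (fun _ _ => PTE.IsTotalSep.of_mul)
    (a := toPTE he (coordEmb i (PartialTransf.ofFull (moveTo a b))))
    (isTotalSep_toPTE he (f := fun k y => if k = i then moveTo a b y else y)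
      (fun k y => by rw [coordEmb_comp]; split_ifs <;> rfl) fun _ _ h => h)
    (fun h => not_isTotalInj_toPTE he (j := i) hab (by simp [coordEmb_comp, moveTo_apply])
      (PTE.isUnit_iff.mp h).1)
  obtain ⟨r, hrS, hr⟩ : ∃ r ∈ S, ¬ PTE.IsTotal r := by
    by_contra! H
    exact not_isTotal_toPTE he (w := coordEmb i (PartialTransf.omitPoint a)) (j := i) (y := a)
      (by simp [coordEmb_comp, PartialTransf.omitPoint_apply])
      (Submonoid.dense_induction (motive := PTE.IsTotal) S hS H PTE.isTotalInj_one.isTotal (fun _ _ => PTE.IsTotal.mul) _)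
  have hne : ∀ {z w : PTE E}, IsUnit z → ¬ IsUnit w → z ≠ w := fun hz hw h => hw (h ▸ hz)
  have hru : ¬ IsUnit r := fun h => hr (PTE.isUnit_iff.mp h).1.isTotal
  have hpq : p ≠ q := by
    rintro rfl
    exact hpu (PTE.isUnit_iff.mpr ⟨hp, hq⟩)
  have hpr : p ≠ r := by
    rintro rfl
    exact hr hp.isTotal
  have hqr : q ≠ r := by
    rintro rfl
    exact hr hq.isTotal
  have hsub : ({x, y, p, q, r} : Set (PTE E)) ⊆ S := by
    rintro _ (rfl | rfl | rfl | rfl | rfl) <;> assumption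
  refine le_trans (le_of_eq ?_) (Set.encard_le_encard hsub)
  rw [Set.encard_insert_of_notMem, Set.encard_insert_of_notMem, Set.encard_insert_of_notMem,
    Set.encard_pair hqr]
  · norm_num
  · simp [hpq, hpr]
  · simp [hne hy hpu, hne hy hqu, hne hy hru]
  · simp [hxy, hne hx hpu, hne hx hqu, hne hx hru]

theorem exists_closure_eq_top_encard_le [Finite X] [Finite Y] (he : IsCoordinates E e) {i j : X}
    (hij : i ≠ j) {a b : Y} (hab : a ≠ b) {x y : PermWreath (Perm Y) X}
    (hxy : Subgroup.closure {x, y} = ⊤) :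
    ∃ S : Set (PTE E), Submonoid.closure S = ⊤ ∧ S.encard ≤ 5 := by
  let T : Set (Wreath (PartialTransf Y) X) := {ofPermWreath x, ofPermWreath y, barEmb (moveTo i j),
    coordEmb i (PartialTransf.ofFull (moveTo a b)), coordEmb i (PartialTransf.omitPoint a)}
  have hsub : T ⊆ Submonoid.closure T := Submonoid.subset_closure
  -- In a finite group `x` and `y` generate the same submonoid as subgroup, so inverses cost no
  -- further generators.
  have hunit : (Submonoid.closure T).comap ofPermWreath = ⊤ := by
    have : Finite (PermWreath (Perm Y) X) := Finite.of_injective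
      (fun a => (a.comp, a.bar)) fun a b h =>
        PermWreath.ext (Prod.ext_iff.mp h).1 (Prod.ext_iff.mp h).2
    rw [eq_top_iff, ← Subgroup.top_toSubmonoid, ← hxy, Subgroup.closure_toSubmonoid_of_finite,
      Submonoid.closure_le]
    rintro _ (rfl | rfl)
    · exact hsub (by simp [T])
    · exact hsub (by simp [T])
  have hT : Submonoid.closure T = ⊤ :=
    eq_top_of_mem (fun a => (hunit ▸ Submonoid.mem_top a :)) hij (hsub (by simp [T])) hab
      (k := i) (hsub (by simp [T])) (c := a) (hsub (by simp [T]))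
  refine ⟨toPTE he '' T, ?_, (Set.encard_image_le _ _).trans ?_⟩
  · rw [← MonoidHom.map_mclosure, hT, ← MonoidHom.mrange_eq_map,
      MonoidHom.mrange_eq_top_of_surjective _ (toPTE_surjective he)]
  · have h1 : ∀ (s : Set (Wreath (PartialTransf Y) X)) (c : ℕ∞) w, s.encard ≤ c →
        (insert w s).encard ≤ c + 1 :=
      fun s c w h => (Set.encard_insert_le s w).trans (by gcongr)
    refine (h1 _ _ _ (h1 _ _ _ (h1 _ _ _ (h1 _ _ _ (Set.encard_singleton _).le)))).trans ?_
    norm_num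

end Wreath

theorem theorem1p1 {Ω : Type*} [Finite Ω] (E : Setoid Ω) (m n : ℕ) (hm : 2 ≤ m) (hn : 2 ≤ n)
    (hE : IsUniformEquiv E m n) :
    (Nat.card (PTE E) : ℤ) = ((m : ℤ) * ((n : ℤ) + 1) ^ n - (m : ℤ) + 1) ^ m ∧
    monoidRank (PTE E) = 5 ∧
    Nonempty (PTE E ≃*
      (pairCon (M := Wreath (PartialTransf (Fin n)) (Fin m))
        (Wreath.coordEmb ⟨0, by omega⟩ (PartialTransf.empty (Fin n)))
        (Wreath.coordEmb ⟨0, by omega⟩ (PartialTransf.empty (Fin n)) *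
          Wreath.barEmb (moveTo ⟨0, by omega⟩ ⟨1, by omega⟩))).Quotient) := by
  obtain ⟨e, he⟩ := hE.exists_isCoordinates
  have hij : (⟨0, by omega⟩ : Fin m) ≠ ⟨1, by omega⟩ := by simp
  have hab : (⟨0, by omega⟩ : Fin n) ≠ ⟨1, by omega⟩ := by simp
  refine ⟨?_, le_antisymm ?_ ?_, ?_⟩
  · simpa using Wreath.card_PTE he ⟨0, by omega⟩
  · obtain ⟨x, y, hxy⟩ := PermWreath.exists_closure_pair_eq_top hm hn
    obtain ⟨S, hS, hcard⟩ := Wreath.exists_closure_eq_top_encard_le he hij hab hxy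
    exact (iInf₂_le S hS).trans hcard
  · exact le_iInf₂ fun S hS => Wreath.five_le_encard he hij hab hS
  · rw [← Wreath.ker_toPTE he hij]
    exact ⟨(Con.quotientKerEquivOfSurjective _ (Wreath.toPTE_surjective he)).symm⟩
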